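/- Let $N$ be a finite set with $|N|\ge 2$, let $\mathcal P(N)$ be its power set, and write $\langle\theta,m\rangle=\sum_{S\subseteq N}\theta(S)m(S)$ for $\theta,m\in\mathbb R^{\mathcal P(N)}$. The core of $m\in\mathbb R^{\mathcal P(N)}$ is $C(m)=\{x\in\mathbb R^N:\ \sum_{i\in N}x_i=m(N),\ \sum_{i\in S}x_i\ge m(S)\text{ for all }S\subseteq N\}$. Let $\mathcal E(N)\subseteq\mathbb R^{\mathcal P(N)}$ be the cone of exact games, that is, of all $m$ with $m(\emptyset)=0$ such that for every $S\subseteq N$ there is $x\in C(m)$ with $\sum_{i\in S}x_i=m(S)$. For $\emptyset\ne D\subseteq N$ let $\tilde\Theta^N_D$ be the polyhedron of all $\theta\in\mathbb R^{\mathcal P(N)}$ such that - $\theta(S)\le 0$ for every $S\subseteq N$ with $S\notin\{\emptyset,D,N\}$, - $\sum_{L\subseteq N}\theta(L)=0$ and $\sum_{L\subseteq N,\ i\in L}\theta(L)=0$ for every $i\in N$, - $\theta(N)+\theta(\emptyset)=1$, and put $\Delta=\operatorname{conv}\bigl(\bigcup_{\emptyset\ne D\subseteq N}\tilde\Theta^N_D\bigr)$.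 An inequality $\langle\theta,m\rangle\ge 0$ is called facet-defining for $\mathcal E(N)$ if it holds for all $m\in\mathcal E(N)$ and the face $\{m\in\mathcal E(N):\langle\theta,m\rangle=0\}$ has dimension $\dim\mathcal E(N)-1$, where the dimension of a non-empty set is the dimension of its affine hull. Then, for every $\theta\in\mathbb R^{\mathcal P(N)}$ with $\sum_{S\subseteq N}\theta(S)=0$ and $\sum_{\emptyset\ne L\subsetneq N}\theta(L)=-1$, the inequality $\langle\theta,m\rangle\ge 0$ is facet-defining for $\mathcal E(N)$ if and only if $\theta$ is a vertex (extreme point) of $\Delta$. -/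

import Mathlib

namespace ExactGames

open Finset

noncomputable section

open Classical in
/-- The dimension of a set in a real vector space: the dimension of the direction of its affine
hull, with the usual convention `-1` for the empty set. -/
def setDim {V : Type*} [AddCommGroup V] [Module ℝ V] (s : Set V) : ℤ :=
  if s = ∅ then -1 else (Module.finrank ℝ (affineSpan ℝ s).direction : ℤ)

/-- The inequality `β ≤ ⟨θ, x⟩` is facet-defining for `P ⊆ ℝ^ι`: it is valid on `P`, and the face of
`P` where it holds with equality is a facet, that is, has dimension `dim P - 1`. -/
def IsFacetDefining {ι : Type*} [Fintype ι] (P : Set (ι → ℝ)) (θ : ι → ℝ) (β : ℝ) : Prop :=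
  (∀ x ∈ P, β ≤ dotProduct θ x) ∧
    setDim {x ∈ P | dotProduct θ x = β} = setDim P - 1

section Games

variable {N : Type*} [Fintype N] [DecidableEq N]

/-- The core of a function on coalitions. -/
def core (m : Finset N → ℝ) : Set (N → ℝ) :=
  {x | ∑ i, x i = m univ ∧ ∀ S : Finset N, m S ≤ ∑ i ∈ S, x i}

/-- `m` is an exact game over `N`: `m ∅ = 0`, and for each coalition `S` the core of `m` contains a
vector that is tight for `S`. -/
def IsExact (m : Finset N → ℝ) : Prop :=
  m ∅ = 0 ∧ ∀ S : Finset N, ∃ x ∈ core m, ∑ i ∈ S, x i = m S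

variable (N) in
/-- The cone of exact games over `N`, inside the space of real functions on coalitions. -/
def exactCone : Set (Finset N → ℝ) :=
  {m | IsExact m}

/-- The auxiliary cone attached to a coalition `D`. -/
def thetaCone (D : Finset N) : Set (Finset N → ℝ) :=
  {θ | (∀ S : Finset N, S ≠ ∅ → S ≠ D → S ≠ univ → θ S ≤ 0) ∧
    ∑ L : Finset N, θ L = 0 ∧
    ∀ i : N, ∑ L : Finset N with i ∈ L, θ L = 0}

/-- The auxiliary polyhedron attached to a coalition `D`. -/
def thetaPolyhedron (D : Finset N) : Set (Finset N → ℝ) :=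
  thetaCone D ∩ {θ | θ univ + θ ∅ = 1}

variable (N) in
/-- The convex hull of the union of the auxiliary polyhedra over all non-empty coalitions. -/
def Delta : Set (Finset N → ℝ) :=
  convexHull ℝ (⋃ D : {D : Finset N // D.Nonempty}, thetaPolyhedron D.1)

end Games

end

end ExactGames

/-!
The exact games form a polyhedral cone, and the statement is the usual duality between its facets
and the extreme rays of its dual cone, of which `Delta` is a base.

A game `m` (with `m ∅ = 0`) has a core vector tight for `D` if and only if `⟨θ, m⟩ ≥ 0` for all `θ` in
`thetaCone D`. One direction is a direct computation. For the other, the set functions that have a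
core vector tight for `D` form a closed convex cone, and any functional separating `m` from that
cone lies in `thetaCone D`, up to its irrelevant value at `∅`
(`exists_tight_of_forall_thetaCone`).

The game `refGame` with value `-1` at all coalitions other than `∅` and `N` is an interior point of
the exact cone within the hyperplane `m ∅ = 0` (`eventually_isExact`), and the normalization of
`θ` says exactly that `⟨θ, refGame⟩ = 1`. Hence the polyhedra `thetaPolyhedron D` are bounded and
generate the cones `thetaCone D`. It follows that `Delta` is the convex hull of a finite set
(`exists_finite_convexHull_eq_Delta`) and consists of all normalized valid inequalities
(`mem_Delta_iff`).

A normalized valid inequality is facet-defining precisely when its face spans the subspace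
`m ∅ = ⟨θ, m⟩ = 0` (`isFacetDefining_iff`). If it does, every convex decomposition of `θ` in
`Delta` vanishes on this subspace and is therefore trivial. Conversely, a vertex `θ` is strictly
separated from the other vertices by an exact game at which only `θ` is tight, and near this game
the face fills the whole subspace.
-/

namespace ExactGames

open Finset Filter Topology

/-! ### Preliminaries on finite-dimensional spaces -/

/-- Every continuous linear functional on `ℝ^ι` is the pairing with a vector. -/
lemma exists_dotProduct_eq {ι : Type*} [Fintype ι] (f : StrongDual ℝ (ι → ℝ)) :
    ∃ θ : ι → ℝ, ∀ m, f m = dotProduct θ m := by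
  classical
  refine ⟨fun i => f (Pi.single i 1), fun m => ?_⟩
  have h := LinearMap.pi_apply_eq_sum_univ (f : (ι → ℝ) →ₗ[ℝ] ℝ) m
  have h2 : ∀ i : ι, (fun j => if i = j then (1 : ℝ) else 0) = Pi.single i 1 := by
    intro i
    ext j
    simp [Pi.single_apply, eq_comm]
  simp only [h2] at h
  simpa [dotProduct, mul_comm] using h

lemma continuous_dotProduct {ι : Type*} [Fintype ι] (θ : ι → ℝ) :
    Continuous fun m : ι → ℝ => dotProduct θ m := by
  unfold dotProduct
  fun_prop

/-- A subset of a subspace `W` that has an interior point relative to `W` spans `W`. -/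
lemma span_eq_of_eventually_mem {ι : Type*} [Fintype ι] {W : Submodule ℝ (ι → ℝ)}
    {s : Set (ι → ℝ)} {p : ι → ℝ} (hsW : s ⊆ W) (hp : p ∈ s)
    (h : ∀ᶠ x in 𝓝 p, x ∈ W → x ∈ s) : Submodule.span ℝ s = W := by
  refine le_antisymm (Submodule.span_le.2 hsW) fun w hw => ?_
  have hc : Tendsto (fun t : ℝ => p + t • w) (𝓝[≠] 0) (𝓝 p) := by
    have : Continuous fun t : ℝ => p + t • w := by fun_prop
    have h0 := this.tendsto 0
    simp only [zero_smul, add_zero] at h0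
    exact h0.mono_left nhdsWithin_le_nhds
  obtain ⟨t, ht, ht0⟩ := ((hc.eventually h).and self_mem_nhdsWithin).exists
  have hmem : p + t • w ∈ s := ht (W.add_mem (hsW hp) (W.smul_mem t hw))
  have h1 : t • w ∈ Submodule.span ℝ s := by
    simpa using Submodule.sub_mem _ (Submodule.subset_span hmem) (Submodule.subset_span hp)
  exact (Submodule.smul_mem_iff _ ht0).1 h1

lemma setDim_eq_finrank_span {V : Type*} [AddCommGroup V] [Module ℝ V] {s : Set V}
    (h0 : (0 : V) ∈ s) : setDim s = Module.finrank ℝ (Submodule.span ℝ s) := by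
  have hne : s ≠ ∅ := Set.Nonempty.ne_empty ⟨0, h0⟩
  have himg : (fun x => x -ᵥ (0 : V)) '' s = s := by simp
  rw [setDim, if_neg hne, direction_affineSpan, vectorSpan_eq_span_vsub_set_right ℝ h0, himg]

section Games

variable {N : Type*} [Fintype N] [DecidableEq N]

/-! ### The dual description of exactness -/

lemma sum_mul_sum_eq_zero {D : Finset N} {θ : Finset N → ℝ} (hθ : θ ∈ thetaCone D) (x : N → ℝ) :
    ∑ S, θ S * ∑ i ∈ S, x i = 0 := by
  have h : ∀ S : Finset N, θ S * ∑ i ∈ S, x i = ∑ i, if i ∈ S then θ S * x i else 0 := by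
    intro S
    rw [Finset.mul_sum, ← Finset.sum_filter]
    simp
  simp_rw [h]
  rw [Finset.sum_comm]
  refine Finset.sum_eq_zero fun i _ => ?_
  rw [← Finset.sum_filter, ← Finset.sum_mul, hθ.2.2 i, zero_mul]

lemma dotProduct_nonneg_of_mem_thetaCone {D : Finset N} {θ m : Finset N → ℝ}
    (hθ : θ ∈ thetaCone D) (hm : IsExact m) : 0 ≤ dotProduct θ m := by
  obtain ⟨x, hx, hxD⟩ := hm.2 D
  have h : dotProduct θ m = ∑ S, θ S * (m S - ∑ i ∈ S, x i) := by
    simp only [mul_sub, Finset.sum_sub_distrib, sum_mul_sum_eq_zero hθ x, sub_zero, dotProduct]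
  rw [h]
  refine Finset.sum_nonneg fun S _ => ?_
  by_cases h1 : S = ∅
  · simp [h1, hm.1]
  by_cases h2 : S = D
  · simp [h2, hxD]
  by_cases h3 : S = univ
  · simp [h3, hx.1]
  exact mul_nonneg_of_nonpos_of_nonpos (hθ.1 S h1 h2 h3) (sub_nonpos.2 (hx.2 S))

/-- Core vectors stay bounded along a convergent sequence of games, so a limit of games having a
core vector tight for `D` has one too. -/
lemma isClosed_setOf_exists_tight (D : Finset N) :
    IsClosed {m : Finset N → ℝ | ∃ x ∈ core m, ∑ i ∈ D, x i = m D} := by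
  refine IsSeqClosed.isClosed fun m m₀ hm hlim => ?_
  choose x hx hxD using hm
  have hlim' : ∀ S, Tendsto (fun k => m k S) atTop (𝓝 (m₀ S)) := fun S =>
    (tendsto_pi_nhds.1 hlim) S
  obtain ⟨C, hC⟩ := (Metric.isBounded_range_of_tendsto m hlim).exists_norm_le
  have hC' : ∀ k S, |m k S| ≤ C := fun k S =>
    (norm_le_pi_norm (m k) S).trans (hC _ ⟨k, rfl⟩)
  have hbox : ∀ k, x k ∈ Set.Icc (fun _ : N => -C) (fun _ : N => 2 * C) := by
    refine fun k => ⟨fun i => ?_, fun i => ?_⟩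
    · have := (hx k).2 {i}
      simp only [sum_singleton] at this
      exact (neg_le_of_abs_le (hC' k {i})).trans this
    · have h1 := (hx k).2 (univ.erase i)
      have h2 := Finset.add_sum_erase univ (x k) (mem_univ i)
      have h3 := (hx k).1
      have h4 := neg_le_of_abs_le (hC' k (univ.erase i))
      have h5 := le_of_abs_le (hC' k univ)
      show x k i ≤ 2 * C
      linarith
  obtain ⟨y, -, φ, hφ, hy⟩ := isCompact_Icc.tendsto_subseq hbox
  have hy' : ∀ S : Finset N, Tendsto (fun k => ∑ i ∈ S, x (φ k) i) atTop (𝓝 (∑ i ∈ S, y i)) :=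
    fun S => tendsto_finsetSum _ fun i _ => (tendsto_pi_nhds.1 hy) i
  have hm' : ∀ S : Finset N, Tendsto (fun k => m (φ k) S) atTop (𝓝 (m₀ S)) := fun S =>
    (hlim' S).comp hφ.tendsto_atTop
  refine ⟨y, ⟨?_, fun S => ?_⟩, ?_⟩
  · exact tendsto_nhds_unique (hy' univ) ((hm' univ).congr fun k => ((hx (φ k)).1).symm)
  · exact le_of_tendsto_of_tendsto' (hm' S) (hy' S) fun k => (hx (φ k)).2 S
  · exact tendsto_nhds_unique (hy' D) ((hm' D).congr fun k => (hxD (φ k)).symm)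

/-- The closed convex cone of set functions having a core vector tight for `D`. -/
def tightCone (D : Finset N) : ProperCone ℝ (Finset N → ℝ) where
  carrier := {m | ∃ x ∈ core m, ∑ i ∈ D, x i = m D}
  add_mem' := by
    rintro m m' ⟨x, hx, hxD⟩ ⟨y, hy, hyD⟩
    refine ⟨x + y, ⟨?_, fun S => ?_⟩, ?_⟩
    · simp [Finset.sum_add_distrib, hx.1, hy.1]
    · simpa [Finset.sum_add_distrib] using add_le_add (hx.2 S) (hy.2 S)
    · simp [Finset.sum_add_distrib, hxD, hyD]
  zero_mem' := ⟨0, ⟨by simp, by simp⟩, by simp⟩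
  smul_mem' := by
    rintro ⟨c, hc⟩ m ⟨x, hx, hxD⟩
    refine ⟨c • x, ⟨?_, fun S => ?_⟩, ?_⟩
    · simp [← Finset.mul_sum, hx.1]
    · simpa [← Finset.mul_sum] using mul_le_mul_of_nonneg_left (hx.2 S) hc
    · simp [← Finset.mul_sum, hxD]
  isClosed' := isClosed_setOf_exists_tight D

lemma mem_tightCone {D : Finset N} {m : Finset N → ℝ} :
    m ∈ tightCone D ↔ ∃ x ∈ core m, ∑ i ∈ D, x i = m D := Iff.rfl

/-- The converse of `dotProduct_nonneg_of_mem_thetaCone`: a functional separating `m` from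
`tightCone D` becomes an element of `thetaCone D` after its value at `∅` is adjusted. -/
lemma exists_tight_of_forall_thetaCone {D : Finset N} {m : Finset N → ℝ} (hm0 : m ∅ = 0)
    (h : ∀ θ ∈ thetaCone D, 0 ≤ dotProduct θ m) : ∃ x ∈ core m, ∑ i ∈ D, x i = m D := by
  by_contra hcon
  obtain ⟨f, hf, hfm⟩ := ProperCone.hyperplane_separation_point (tightCone D) (x₀ := m) hcon
  obtain ⟨θ, hθ⟩ := exists_dotProduct_eq f
  simp only [hθ] at hf hfm
  have hneg : ∀ S : Finset N, S ≠ ∅ → S ≠ D → S ≠ univ → θ S ≤ 0 := by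
    intro S _ hSD hSN
    have := hf (-Pi.single S 1) (mem_tightCone.2 ⟨0, ⟨by simp [hSN.symm], fun T => ?_⟩,
      by simp [hSD.symm]⟩)
    · simpa using this
    · by_cases hT : T = S <;> simp [hT]
  have hmod : ∀ x : N → ℝ, 0 ≤ ∑ S, θ S * ∑ i ∈ S, x i := fun x =>
    hf (fun S => ∑ i ∈ S, x i) (mem_tightCone.2 ⟨x, ⟨rfl, fun S => le_rfl⟩, rfl⟩)
  have hpt : ∀ i : N, ∑ L : Finset N with i ∈ L, θ L = 0 := by
    intro i
    have h1 := hmod (Pi.single i 1)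
    have h2 := hmod (-Pi.single i 1)
    have hsingle : ∀ S : Finset N, θ S * ∑ j ∈ S, (Pi.single i 1 : N → ℝ) j =
        if i ∈ S then θ S else 0 := by
      intro S
      simp [Pi.single_apply]
    simp only [Pi.neg_apply, Finset.sum_neg_distrib, mul_neg, hsingle,
      ← Finset.sum_filter] at h1 h2
    linarith
  have hupd : ∀ S : Finset N, S ≠ ∅ →
      (θ - Pi.single ∅ (∑ L, θ L) : Finset N → ℝ) S = θ S := by
    intro S hS
    simp [hS]
  have hmem : θ - Pi.single ∅ (∑ L, θ L) ∈ thetaCone D := by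
    refine ⟨fun S h1 h2 h3 => ?_, ?_, fun i => ?_⟩
    · rw [hupd S h1]
      exact hneg S h1 h2 h3
    · simp [Finset.sum_sub_distrib]
    · rw [← hpt i]
      refine Finset.sum_congr rfl fun L hL => hupd L ?_
      rintro rfl
      simp at hL
  have := h _ hmem
  rw [sub_dotProduct, single_dotProduct, hm0] at this
  linarith

lemma isExact_of_forall_thetaCone [Nonempty N] {m : Finset N → ℝ} (hm0 : m ∅ = 0)
    (h : ∀ D : Finset N, D.Nonempty → ∀ θ ∈ thetaCone D, 0 ≤ dotProduct θ m) : IsExact m := by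
  refine ⟨hm0, fun S => ?_⟩
  rcases S.eq_empty_or_nonempty with rfl | hS
  · -- every core vector is tight for the empty coalition
    obtain ⟨x, hx, -⟩ := exists_tight_of_forall_thetaCone hm0 (h univ univ_nonempty)
    exact ⟨x, hx, by simp [hm0]⟩
  · exact exists_tight_of_forall_thetaCone hm0 (h S hS)

/-! ### An interior point of the exact cone -/

variable (N) in
/-- The game with value `0` at the empty and the grand coalition and `-1` at all others. -/
noncomputable def refGame : Finset N → ℝ := fun S => if S = ∅ ∨ S = univ then 0 else -1

/-- The vector with total mass `m N` whose mass on `D` is `m D`, uniform on `D` and on its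
complement. -/
noncomputable def tightVec (D : Finset N) (m : Finset N → ℝ) : N → ℝ := fun i =>
  if i ∈ D then m D / (#D : ℝ) else (m univ - m D) / (#Dᶜ : ℝ)

lemma sum_tightVec {D : Finset N} (hD : D.Nonempty) (m : Finset N → ℝ) :
    ∑ i ∈ D, tightVec D m i = m D := by
  have h : (#D : ℝ) ≠ 0 := by exact_mod_cast hD.card_pos.ne'
  have hv : ∀ i ∈ D, tightVec D m i = m D / (#D : ℝ) := fun i hi => if_pos hi
  rw [Finset.sum_congr rfl hv]
  simp only [sum_const, nsmul_eq_mul]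
  field_simp

lemma sum_univ_tightVec {D : Finset N} (hD : D.Nonempty) (m : Finset N → ℝ) :
    ∑ i, tightVec D m i = m univ := by
  have hv : ∀ i ∈ Dᶜ, tightVec D m i = (m univ - m D) / (#Dᶜ : ℝ) := fun i hi =>
    if_neg (mem_compl.1 hi)
  rw [← Finset.sum_add_sum_compl D, sum_tightVec hD, Finset.sum_congr rfl hv]
  by_cases hD' : D = univ
  · simp [hD']
  · have h : (#Dᶜ : ℝ) ≠ 0 := by
      have : Dᶜ.Nonempty := by rwa [nonempty_iff_ne_empty, Ne, compl_eq_empty_iff]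
      exact_mod_cast this.card_pos.ne'
    simp only [sum_const, nsmul_eq_mul]
    field_simp
    ring

lemma refGame_lt_sum_tightVec {D S : Finset N} (hD : D.Nonempty) (hS : S ≠ ∅) (hSD : S ≠ D)
    (hSN : S ≠ univ) : refGame N S < ∑ i ∈ S, tightVec D (refGame N) i := by
  have hSv : refGame N S = -1 := by simp [refGame, hS, hSN]
  by_cases hDN : D = univ
  · have h0 : ∀ i, tightVec D (refGame N) i = 0 := by
      intro i
      simp [tightVec, hDN, refGame]
    simp [hSv, h0]
  have hDv : refGame N D = -1 := by simp [refGame, hD.ne_empty, hDN]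
  have hNv : refGame N univ = 0 := by simp [refGame]
  have hneg : ∀ i ∈ D, tightVec D (refGame N) i < 0 := by
    intro i hi
    rw [tightVec, if_pos hi, hDv]
    exact div_neg_of_neg_of_pos (by norm_num) (by exact_mod_cast hD.card_pos)
  have hpos : ∀ i ∉ D, 0 < tightVec D (refGame N) i := by
    intro i hi
    rw [tightVec, if_neg hi, hDv, hNv]
    have : 0 < #Dᶜ := card_pos.2 ⟨i, mem_compl.2 hi⟩
    exact div_pos (by norm_num) (by exact_mod_cast this)
  -- the mass of `S` exceeds that of `D`, because passing from `D` to `S` only removes negative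
  -- entries and adds positive ones
  have hdiff := Finset.sum_sdiff_sub_sum_sdiff (s₁ := D) (s₂ := S) (f := tightVec D (refGame N))
  rw [sum_tightVec hD, hDv] at hdiff
  have h1 : 0 ≤ ∑ i ∈ S \ D, tightVec D (refGame N) i :=
    Finset.sum_nonneg fun i hi => (hpos i (mem_sdiff.1 hi).2).le
  have h2 : ∑ i ∈ D \ S, tightVec D (refGame N) i ≤ 0 :=
    Finset.sum_nonpos fun i hi => (hneg i (mem_sdiff.1 hi).1).le
  rw [hSv]
  by_cases hsub : (D \ S).Nonempty
  · have := Finset.sum_neg (fun i hi => hneg i (mem_sdiff.1 hi).1) hsub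
    linarith
  · have hDS : D ⊆ S := by
      rwa [not_nonempty_iff_eq_empty, sdiff_eq_empty_iff_subset] at hsub
    have : (S \ D).Nonempty := by
      rw [sdiff_nonempty]
      exact fun h => hSD (subset_antisymm h hDS)
    have := Finset.sum_pos (fun i hi => hpos i (mem_sdiff.1 hi).2) this
    linarith

lemma eventually_isExact [Nonempty N] :
    ∀ᶠ m in 𝓝 (refGame N), m ∅ = 0 → IsExact m := by
  have hcont : ∀ (D S : Finset N), Continuous fun m => ∑ i ∈ S, tightVec D m i := by
    intro D S
    refine continuous_finsetSum _ fun i _ => ?_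
    unfold tightVec
    split_ifs <;> fun_prop
  have hev : ∀ᶠ m in 𝓝 (refGame N), ∀ D S : Finset N, D.Nonempty → S ≠ ∅ → S ≠ D → S ≠ univ →
      m S < ∑ i ∈ S, tightVec D m i := by
    simp only [eventually_all]
    intro D S hD h1 h2 h3
    exact (continuous_apply S).continuousAt.eventually_lt (hcont D S).continuousAt
      (refGame_lt_sum_tightVec hD h1 h2 h3)
  filter_upwards [hev] with m hm hm0
  have hcore : ∀ D : Finset N, D.Nonempty → tightVec D m ∈ core m := by
    refine fun D hD => ⟨sum_univ_tightVec hD m, fun S => ?_⟩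
    by_cases h1 : S = ∅
    · simp [h1, hm0]
    by_cases h2 : S = D
    · rw [h2, sum_tightVec hD]
    by_cases h3 : S = univ
    · rw [h3, sum_univ_tightVec hD]
    exact (hm D S hD h1 h2 h3).le
  refine ⟨hm0, fun D => ?_⟩
  rcases D.eq_empty_or_nonempty with rfl | hD
  · exact ⟨_, hcore univ univ_nonempty, by simp [hm0]⟩
  · exact ⟨_, hcore D hD, sum_tightVec hD m⟩

lemma refGame_empty : refGame N ∅ = 0 := by simp [refGame]

lemma isExact_refGame [Nonempty N] : IsExact (refGame N) :=
  eventually_isExact.self_of_nhds refGame_empty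

/-- The normalization in `thetaPolyhedron` is the pairing with the interior point `refGame`. -/
lemma dotProduct_refGame [Nonempty N] {θ : Finset N → ℝ} (hθ : ∑ S, θ S = 0) :
    dotProduct θ (refGame N) = θ univ + θ ∅ := by
  have hne : (univ : Finset N) ≠ ∅ := univ_nonempty.ne_empty
  have h : dotProduct θ (refGame N) = ∑ S, θ S * (refGame N S + 1) := by
    simp [mul_add, Finset.sum_add_distrib, hθ, dotProduct]
  rw [h, ← Finset.sum_pair hne, ← Finset.sum_subset (subset_univ {univ, ∅})]
  · refine Finset.sum_congr rfl fun S hS => ?_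
    have : S = ∅ ∨ S = univ := by simpa [or_comm] using hS
    simp [refGame, this]
  · intro S _ hS
    have : ¬(S = ∅ ∨ S = univ) := by simpa [or_comm] using hS
    simp [refGame, this]

/-- Since `refGame` is an interior point, the coefficients of a valid inequality are controlled by
its value there. -/
lemma exists_mul_abs_le_dotProduct_refGame [Nonempty N] : ∃ ε > 0, ∀ θ : Finset N → ℝ,
    (∀ m ∈ exactCone N, 0 ≤ dotProduct θ m) →
      ∀ S, S ≠ ∅ → ε * |θ S| ≤ dotProduct θ (refGame N) := by
  obtain ⟨δ, hδ, hball⟩ := Metric.eventually_nhds_iff.1 (eventually_isExact (N := N))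
  refine ⟨δ / 2, half_pos hδ, fun θ hθ S hS => ?_⟩
  have key : ∀ t : ℝ, |t| = δ / 2 → 0 ≤ dotProduct θ (refGame N) + t * θ S := by
    intro t ht
    have hex : IsExact (refGame N + Pi.single S t) := by
      refine hball ?_ (by simp [refGame_empty, hS.symm])
      rw [dist_eq_norm, add_sub_cancel_left, Pi.norm_single, Real.norm_eq_abs, ht]
      exact half_lt_self hδ
    have := hθ _ hex
    rwa [dotProduct_add, dotProduct_single, mul_comm (θ S)] at this
  have h1 := key (δ / 2) (abs_of_pos (half_pos hδ))
  have h2 := key (-(δ / 2)) (by rw [abs_neg, abs_of_pos (half_pos hδ)])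
  rcases abs_cases (θ S) with ⟨h, -⟩ | ⟨h, -⟩ <;> rw [h] <;> linarith

/-! ### `Delta` as a polytope of valid inequalities -/

lemma Delta_subset : Delta N ⊆ {θ | ∑ S, θ S = 0 ∧ θ univ + θ ∅ = 1 ∧
    ∀ m ∈ exactCone N, 0 ≤ dotProduct θ m} := by
  refine convexHull_min (Set.iUnion_subset fun D θ hθ => ⟨hθ.1.2.1, hθ.2, fun m hm =>
    dotProduct_nonneg_of_mem_thetaCone hθ.1 hm⟩) ?_
  rintro θ ⟨h1, h2, h3⟩ η ⟨k1, k2, k3⟩ a b ha hb hab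
  refine ⟨?_, ?_, fun m hm => ?_⟩
  · simp [Finset.sum_add_distrib, ← Finset.mul_sum, h1, k1]
  · simp only [Pi.add_apply, Pi.smul_apply, smul_eq_mul]
    linear_combination a * h2 + b * k2 + hab
  · rw [add_dotProduct, smul_dotProduct, smul_dotProduct]
    exact add_nonneg (mul_nonneg ha (h3 m hm)) (mul_nonneg hb (k3 m hm))

lemma thetaPolyhedron_subset_Delta {D : Finset N} (hD : D.Nonempty) :
    thetaPolyhedron D ⊆ Delta N :=
  (Set.subset_iUnion (fun D : {D : Finset N // D.Nonempty} => thetaPolyhedron D.1) ⟨D, hD⟩).trans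
    (subset_convexHull ℝ _)

/-- The polyhedra `thetaPolyhedron D` generate the cones `thetaCone D`, because an element of
`thetaCone D` that vanishes at the interior point `refGame` is zero. -/
lemma isExact_of_forall_Delta [Nonempty N] {m : Finset N → ℝ} (hm0 : m ∅ = 0)
    (h : ∀ θ ∈ Delta N, 0 ≤ dotProduct θ m) : IsExact m := by
  refine isExact_of_forall_thetaCone hm0 fun D hD θ hθ => ?_
  have hval : ∀ m ∈ exactCone N, 0 ≤ dotProduct θ m := fun m hm =>
    dotProduct_nonneg_of_mem_thetaCone hθ hm
  have hc := hval _ (isExact_refGame (N := N))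
  rcases hc.eq_or_lt with hc | hc
  · obtain ⟨ε, hε, hbd⟩ := exists_mul_abs_le_dotProduct_refGame (N := N)
    have hz : ∀ S, S ≠ ∅ → θ S = 0 := by
      intro S hS
      have h1 := hbd θ hval S hS
      rw [← hc] at h1
      exact abs_nonpos_iff.1 (nonpos_of_mul_nonpos_right h1 hε)
    refine (Finset.sum_eq_zero fun S _ => ?_ : dotProduct θ m = 0).ge
    by_cases hS : S = ∅
    · rw [hS, hm0, mul_zero]
    · rw [hz S hS, zero_mul]
  · have hmem : (dotProduct θ (refGame N))⁻¹ • θ ∈ thetaPolyhedron D := by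
      refine ⟨⟨fun S h1 h2 h3 => ?_, ?_, fun i => ?_⟩, ?_⟩
      · exact mul_nonpos_of_nonneg_of_nonpos (inv_nonneg.2 hc.le) (hθ.1 S h1 h2 h3)
      · simp [← Finset.mul_sum, hθ.2.1]
      · simp [← Finset.mul_sum, hθ.2.2 i]
      · simp only [Set.mem_ofPred_eq, Pi.smul_apply, smul_eq_mul, ← mul_add,
          ← dotProduct_refGame hθ.2.1]
        exact inv_mul_cancel₀ hc.ne'
    have h1 := h _ (thetaPolyhedron_subset_Delta hD hmem)
    rw [smul_dotProduct, smul_eq_mul] at h1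
    exact nonneg_of_mul_nonneg_right h1 (inv_pos.2 hc)

lemma isCompact_thetaPolyhedron [Nonempty N] {D : Finset N} (hD : D.Nonempty) :
    IsCompact (thetaPolyhedron D) := by
  obtain ⟨ε, hε, hbd⟩ := exists_mul_abs_le_dotProduct_refGame (N := N)
  have hclosed : IsClosed (thetaPolyhedron D) := by
    unfold thetaPolyhedron thetaCone
    simp only [Set.ofPred_and, Set.ofPred_forall]
    refine IsClosed.inter (IsClosed.inter ?_ (IsClosed.inter ?_ ?_)) ?_
    · refine isClosed_iInter fun S => isClosed_iInter fun _ => isClosed_iInter fun _ =>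
        isClosed_iInter fun _ => isClosed_le (by fun_prop) (by fun_prop)
    · exact isClosed_eq (by fun_prop) (by fun_prop)
    · exact isClosed_iInter fun i => isClosed_eq (by fun_prop) (by fun_prop)
    · exact isClosed_eq (by fun_prop) (by fun_prop)
  refine IsCompact.of_isClosed_subset (isCompact_Icc (a := fun _ => -(1 / ε + 1))
    (b := fun _ => 1 / ε + 1)) hclosed fun θ hθ => ?_
  obtain ⟨h1, h2, h3⟩ := Delta_subset (thetaPolyhedron_subset_Delta hD hθ)
  have hS : ∀ S, S ≠ ∅ → |θ S| ≤ 1 / ε := by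
    intro S hS
    have := hbd θ h3 S hS
    rw [dotProduct_refGame h1, h2] at this
    rwa [le_div_iff₀' hε]
  have hall : ∀ S, |θ S| ≤ 1 / ε + 1 := by
    intro S
    by_cases hS0 : S = ∅
    · have h4 := hS univ univ_nonempty.ne_empty
      have h5 : θ ∅ = 1 - θ univ := by linarith
      rw [hS0, h5]
      exact (abs_sub _ _).trans (by rw [abs_one]; linarith)
    · linarith [hS S hS0]
  exact ⟨fun S => neg_le_of_abs_le (hall S), fun S => le_of_abs_le (hall S)⟩

lemma convex_thetaPolyhedron (D : Finset N) : Convex ℝ (thetaPolyhedron D) := by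
  rintro θ ⟨⟨h1, h2, h3⟩, h4⟩ η ⟨⟨k1, k2, k3⟩, k4⟩ a b ha hb hab
  simp only [Set.mem_ofPred_eq] at h4 k4
  refine ⟨⟨fun S hS hSD hSN => ?_, ?_, fun i => ?_⟩, ?_⟩
  · exact add_nonpos (mul_nonpos_of_nonneg_of_nonpos ha (h1 S hS hSD hSN))
      (mul_nonpos_of_nonneg_of_nonpos hb (k1 S hS hSD hSN))
  · simp [Finset.sum_add_distrib, ← Finset.mul_sum, h2, k2]
  · simp [Finset.sum_add_distrib, ← Finset.mul_sum, h3 i, k3 i]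
  · simp only [Set.mem_ofPred_eq, Pi.add_apply, Pi.smul_apply, smul_eq_mul]
    linear_combination a * h4 + b * k4 + hab

/-- An extreme point of `thetaPolyhedron D` is determined by its set of zeros, so there are only
finitely many of them. -/
lemma finite_extremePoints_thetaPolyhedron (D : Finset N) :
    (Set.extremePoints ℝ (thetaPolyhedron D)).Finite := by
  refine Set.Finite.of_injOn (f := fun θ : Finset N → ℝ => {S | θ S = 0})
    (t := Set.univ) (fun _ _ => Set.mem_univ _) ?_ Set.finite_univ
  intro θ hθ η hη hz
  have hz' : ∀ S, θ S = 0 → η S = 0 := fun S hS => (Set.ext_iff.1 hz S).1 hS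
  obtain ⟨⟨⟨h1, h2, h3⟩, h4⟩, hext⟩ := hθ
  obtain ⟨⟨⟨k1, k2, k3⟩, k4⟩, -⟩ := hη
  simp only [Set.mem_ofPred_eq] at h4 k4
  have hev : ∀ᶠ t : ℝ in 𝓝 0, θ + t • (η - θ) ∈ thetaPolyhedron D := by
    have hneg : ∀ᶠ t : ℝ in 𝓝 0, ∀ S, S ≠ ∅ → S ≠ D → S ≠ univ →
        θ S + t * (η S - θ S) ≤ 0 := by
      simp only [eventually_all]
      intro S hS hSD hSN
      rcases (h1 S hS hSD hSN).eq_or_lt with h0 | h0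
      · simp [h0, hz' S h0]
      · have hc : Continuous fun t : ℝ => θ S + t * (η S - θ S) := by fun_prop
        have := hc.continuousAt.eventually_lt (continuous_const (y := (0 : ℝ))).continuousAt
          (show θ S + (0 : ℝ) * (η S - θ S) < 0 by simpa using h0)
        exact this.mono fun t ht => ht.le
    filter_upwards [hneg] with t ht
    refine ⟨⟨ht, ?_, fun i => ?_⟩, ?_⟩
    · simp [Finset.sum_add_distrib, Finset.sum_sub_distrib, ← Finset.mul_sum, h2, k2]
    · simp [Finset.sum_add_distrib, Finset.sum_sub_distrib, ← Finset.mul_sum, h3 i, k3 i]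
    · simp only [Set.mem_ofPred_eq, Pi.add_apply, Pi.smul_apply, Pi.sub_apply, smul_eq_mul]
      linear_combination (1 - t) * h4 + t * k4
  obtain ⟨δ, hδ, hball⟩ := Metric.eventually_nhds_iff.1 hev
  have hδ' : |δ / 2| < δ := by
    rw [abs_of_pos (half_pos hδ)]
    exact half_lt_self hδ
  have hp := hball (y := δ / 2) (by rwa [dist_zero_right, Real.norm_eq_abs])
  have hm := hball (y := -(δ / 2)) (by rwa [dist_zero_right, norm_neg, Real.norm_eq_abs])
  have heq := hext hp hm ⟨1 / 2, 1 / 2, by norm_num, by norm_num, by norm_num, by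
    ext S
    simp only [Pi.add_apply, Pi.smul_apply, Pi.sub_apply, smul_eq_mul]
    ring⟩
  have h5 : (δ / 2) • (η - θ) = 0 := by simpa using heq
  rcases smul_eq_zero.1 h5 with h6 | h6
  · exact absurd h6 (half_pos hδ).ne'
  · exact (sub_eq_zero.1 h6).symm

lemma exists_finite_convexHull_eq_Delta [Nonempty N] :
    ∃ V : Set (Finset N → ℝ), V.Finite ∧ convexHull ℝ V = Delta N := by
  refine ⟨⋃ D : {D : Finset N // D.Nonempty}, Set.extremePoints ℝ (thetaPolyhedron D.1),
    Set.finite_iUnion fun D => finite_extremePoints_thetaPolyhedron D.1,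
    Set.Subset.antisymm (convexHull_mono (Set.iUnion_mono fun D => extremePoints_subset)) ?_⟩
  refine convexHull_min (Set.iUnion_subset fun D => ?_) (convex_convexHull ℝ _)
  -- Krein–Milman; the closure is superfluous for finitely many extreme points
  rw [← closure_convexHull_extremePoints (isCompact_thetaPolyhedron D.2)
    (convex_thetaPolyhedron D.1),
    ((finite_extremePoints_thetaPolyhedron D.1).isClosed_convexHull ℝ).closure_eq]
  exact convexHull_mono (Set.subset_iUnion
    (fun D : {D : Finset N // D.Nonempty} => Set.extremePoints ℝ (thetaPolyhedron D.1)) D)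

/-- Strict separation inside the affine space of normalized inequalities. The separating level can
be taken to be `0`, since subtracting multiples of `refGame` and of the constant function shifts
the functional by a constant there. -/
lemma exists_game_separating [Nonempty N] {s : Set (Finset N → ℝ)} (hconv : Convex ℝ s)
    (hclosed : IsClosed s) (hs : ∀ v ∈ s, ∑ S, v S = 0 ∧ v univ + v ∅ = 1) {θ : Finset N → ℝ}
    (hsum : ∑ S, θ S = 0) (hnorm : θ univ + θ ∅ = 1) (hθ : θ ∉ s) :
    ∃ m : Finset N → ℝ, m ∅ = 0 ∧ dotProduct θ m < 0 ∧ ∀ v ∈ s, 0 < dotProduct v m := by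
  obtain ⟨f, u, hfu, hf⟩ := geometric_hahn_banach_point_closed hconv hclosed hθ
  obtain ⟨μ, hμ⟩ := exists_dotProduct_eq f
  have key : ∀ v : Finset N → ℝ, ∑ S, v S = 0 → v univ + v ∅ = 1 →
      dotProduct v (μ - u • refGame N - fun _ => μ ∅) = f v - u := by
    intro v h1 h2
    have h3 : dotProduct v (fun _ => μ ∅) = 0 := by
      simp [dotProduct, ← Finset.sum_mul, h1]
    rw [dotProduct_sub, dotProduct_sub, dotProduct_smul, dotProduct_refGame h1, h2, h3, hμ,
      dotProduct_comm μ v]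
    simp
  refine ⟨_, ?_, (key θ hsum hnorm).trans_lt (by linarith), fun v hv => ?_⟩
  · simp [refGame_empty]
  · rw [key v (hs v hv).1 (hs v hv).2]
    linarith [hf v hv]

/-- `Delta` consists of all normalized valid inequalities. -/
lemma mem_Delta_iff [Nonempty N] {θ : Finset N → ℝ} : θ ∈ Delta N ↔
    ∑ S, θ S = 0 ∧ θ univ + θ ∅ = 1 ∧ ∀ m ∈ exactCone N, 0 ≤ dotProduct θ m := by
  refine ⟨fun h => Delta_subset h, fun ⟨h1, h2, h3⟩ => ?_⟩
  by_contra hcon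
  obtain ⟨V, hV, hVD⟩ := exists_finite_convexHull_eq_Delta (N := N)
  have hclosed : IsClosed (Delta N) := hVD ▸ hV.isClosed_convexHull ℝ
  obtain ⟨m, hm0, hmθ, hmD⟩ := exists_game_separating (convex_convexHull ℝ _) hclosed
    (fun v hv => ⟨(Delta_subset hv).1, (Delta_subset hv).2.1⟩) h1 h2 hcon
  exact absurd (h3 m (isExact_of_forall_Delta hm0 fun v hv => (hmD v hv).le)) (not_le.2 hmθ)

/-! ### Facets and dimensions -/

variable (N) in
/-- The hyperplane of set functions vanishing at the empty coalition. -/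
def gameSpace : Submodule ℝ (Finset N → ℝ) :=
  LinearMap.ker (LinearMap.proj (R := ℝ) (φ := fun _ : Finset N => ℝ) ∅)

/-- The games on which the inequality given by `θ` is tight. -/
def tightSpace (θ : Finset N → ℝ) : Submodule ℝ (Finset N → ℝ) :=
  (LinearMap.ker ((dotProductBilin ℝ ℝ θ).comp (gameSpace N).subtype)).map (gameSpace N).subtype

lemma mem_gameSpace {M : Type*} {m : Finset M → ℝ} : m ∈ gameSpace M ↔ m ∅ = 0 := by
  simp [gameSpace]

lemma mem_tightSpace {M : Type*} [Fintype M] {θ m : Finset M → ℝ} :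
    m ∈ tightSpace θ ↔ m ∅ = 0 ∧ dotProduct θ m = 0 := by
  simp [tightSpace, mem_gameSpace, dotProductBilin, and_comm]

lemma finrank_tightSpace_add_one {M : Type*} [Fintype M] {θ m : Finset M → ℝ} (hm0 : m ∅ = 0)
    (hm : dotProduct θ m ≠ 0) :
    Module.finrank ℝ (tightSpace θ) + 1 = Module.finrank ℝ (gameSpace M) := by
  set φ : gameSpace M →ₗ[ℝ] ℝ := (dotProductBilin ℝ ℝ θ).comp (gameSpace M).subtype
  have h1 := LinearMap.finrank_range_add_finrank_ker φ
  have h2 : Module.finrank ℝ (LinearMap.range φ) = 1 := by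
    rw [LinearMap.range_eq_top.2 (LinearMap.surjective fun h => hm ?_), finrank_top,
      Module.finrank_self]
    exact LinearMap.congr_fun h ⟨m, mem_gameSpace.2 hm0⟩
  have h3 : Module.finrank ℝ (tightSpace θ) = Module.finrank ℝ (LinearMap.ker φ) :=
    Submodule.finrank_map_subtype_eq _ _
  omega

lemma span_exactCone [Nonempty N] : Submodule.span ℝ (exactCone N) = gameSpace N :=
  span_eq_of_eventually_mem (fun _ hm => mem_gameSpace.2 hm.1) (isExact_refGame (N := N))
    (eventually_isExact.mono fun _ h hm => h (mem_gameSpace.1 hm))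

lemma isExact_zero {M : Type*} [Fintype M] : IsExact (0 : Finset M → ℝ) :=
  ⟨rfl, fun _ => ⟨0, ⟨by simp, by simp⟩, by simp⟩⟩

/-- A normalized valid inequality is facet-defining if and only if its face spans the whole
hyperplane that the inequality cuts out of the space of games. -/
lemma isFacetDefining_iff [Nonempty N] {θ : Finset N → ℝ} (hsum : ∑ S, θ S = 0)
    (hnorm : θ univ + θ ∅ = 1) : IsFacetDefining (exactCone N) θ 0 ↔
      (∀ m ∈ exactCone N, 0 ≤ dotProduct θ m) ∧
        Submodule.span ℝ {m ∈ exactCone N | dotProduct θ m = 0} = tightSpace θ := by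
  have hle : Submodule.span ℝ {m ∈ exactCone N | dotProduct θ m = 0} ≤ tightSpace θ :=
    Submodule.span_le.2 fun m hm => mem_tightSpace.2 ⟨hm.1.1, hm.2⟩
  have hdim : Module.finrank ℝ (tightSpace θ) + 1 = Module.finrank ℝ (gameSpace N) :=
    finrank_tightSpace_add_one refGame_empty (by rw [dotProduct_refGame hsum, hnorm]; norm_num)
  rw [IsFacetDefining, setDim_eq_finrank_span (show (0 : Finset N → ℝ) ∈ exactCone N from
    isExact_zero), setDim_eq_finrank_span (⟨isExact_zero, by simp⟩ :
      (0 : Finset N → ℝ) ∈ {m ∈ exactCone N | dotProduct θ m = 0}), span_exactCone, ← hdim]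
  refine and_congr_right fun _ => ⟨fun h => Submodule.eq_of_le_of_finrank_eq hle ?_, fun h => ?_⟩
  · push_cast at h
    omega
  · rw [h]
    push_cast
    ring

/-- A normalized valid inequality that is tight on the facet given by `θ` is `θ` itself. -/
lemma eq_of_tightSpace_le [Nonempty N] {θ η : Finset N → ℝ} (hsum : ∑ S, θ S = 0)
    (hnorm : θ univ + θ ∅ = 1) (hsum' : ∑ S, η S = 0) (hnorm' : η univ + η ∅ = 1)
    (h : ∀ m ∈ tightSpace θ, dotProduct η m = 0) : η = θ := by
  have hpair : ∀ S, S ≠ ∅ → η S = θ S := by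
    intro S hS
    -- project the unit vector at `S` along `refGame`, on which both functionals take the value `1`
    have h1 := h (Pi.single S 1 - θ S • refGame N) (mem_tightSpace.2 ⟨by
      simp [refGame_empty, hS.symm], by
      simp [dotProduct_sub, dotProduct_smul, dotProduct_refGame hsum, hnorm]⟩)
    simp only [dotProduct_sub, dotProduct_smul, dotProduct_refGame hsum', hnorm',
      dotProduct_single, smul_eq_mul] at h1
    linarith
  ext S
  by_cases hS : S = ∅
  · have := hpair univ univ_nonempty.ne_empty
    rw [hS]
    linarith
  · exact hpair S hS

lemma mem_extremePoints_of_span_eq [Nonempty N] {θ : Finset N → ℝ} (hθ : θ ∈ Delta N)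
    (hspan : Submodule.span ℝ {m ∈ exactCone N | dotProduct θ m = 0} = tightSpace θ) :
    θ ∈ Set.extremePoints ℝ (Delta N) := by
  refine ⟨hθ, fun η hη ξ hξ hseg => ?_⟩
  obtain ⟨a, b, ha, hb, hab, rfl⟩ := hseg
  obtain ⟨h1, h2, h3⟩ := Delta_subset hη
  obtain ⟨-, -, k3⟩ := Delta_subset hξ
  obtain ⟨l1, l2, -⟩ := Delta_subset hθ
  refine eq_of_tightSpace_le l1 l2 h1 h2 fun m hm => ?_
  have hker : Submodule.span ℝ {m ∈ exactCone N | dotProduct (a • η + b • ξ) m = 0} ≤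
      LinearMap.ker (dotProductBilin ℝ ℝ η) := by
    refine Submodule.span_le.2 fun m hm => ?_
    have h4 := hm.2
    rw [add_dotProduct, smul_dotProduct, smul_dotProduct, smul_eq_mul, smul_eq_mul] at h4
    have h5 := mul_nonneg hb.le (k3 m hm.1)
    have h6 : a * dotProduct η m ≤ 0 := by linarith
    exact le_antisymm (nonpos_of_mul_nonpos_right h6 ha) (h3 m hm.1)
  exact hker (hspan ▸ hm)

/-- A vertex `θ` of `Delta` can be strictly separated from the finitely many other vertices, which
yields an exact game on which `θ` is the only tight vertex; it lies in the relative interior of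
the face, which is therefore a facet. -/
lemma span_eq_of_mem_extremePoints [Nonempty N] {θ : Finset N → ℝ}
    (hθ : θ ∈ Set.extremePoints ℝ (Delta N)) :
    Submodule.span ℝ {m ∈ exactCone N | dotProduct θ m = 0} = tightSpace θ := by
  obtain ⟨V, hV, hVD⟩ := exists_finite_convexHull_eq_Delta (N := N)
  obtain ⟨h1, h2, -⟩ := Delta_subset hθ.1
  have hsub : convexHull ℝ (V \ {θ}) ⊆ Delta N := hVD ▸ convexHull_mono Set.sdiff_subset
  have hnot : θ ∉ convexHull ℝ (V \ {θ}) := by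
    intro hmem
    have := extremePoints_convexHull_subset
      (inter_extremePoints_subset_extremePoints_of_subset hsub ⟨hmem, hθ⟩)
    exact this.2 rfl
  obtain ⟨m, hm0, hmθ, hmV⟩ := exists_game_separating (convex_convexHull ℝ _)
    ((hV.subset Set.sdiff_subset).isClosed_convexHull ℝ)
    (fun v hv => ⟨(Delta_subset (hsub hv)).1, (Delta_subset (hsub hv)).2.1⟩) h1 h2 hnot
  set p := m - dotProduct θ m • refGame N with hp
  have hp0 : p ∅ = 0 := by simp [hp, hm0, refGame_empty]
  have hpθ : dotProduct θ p = 0 := by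
    simp [hp, dotProduct_sub, dotProduct_smul, dotProduct_refGame h1, h2]
  have hpV : ∀ v ∈ V \ {θ}, 0 < dotProduct v p := by
    intro v hv
    have hv' := subset_convexHull ℝ _ hv
    obtain ⟨k1, k2, -⟩ := Delta_subset (hsub hv')
    simp only [hp, dotProduct_sub, dotProduct_smul, dotProduct_refGame k1, k2, smul_eq_mul]
    linarith [hmV v hv']
  have hev : ∀ᶠ x in 𝓝 p, ∀ v ∈ V \ {θ}, 0 < dotProduct v x :=
    (hV.subset Set.sdiff_subset).eventually_all.2 fun v hv =>
      (continuous_dotProduct v).continuousAt.eventually (lt_mem_nhds (hpV v hv))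
  have hev' : ∀ᶠ x in 𝓝 p, x ∈ tightSpace θ →
      x ∈ {m ∈ exactCone N | dotProduct θ m = 0} := by
    filter_upwards [hev] with x hx hxθ
    obtain ⟨hx0, hxθ⟩ := mem_tightSpace.1 hxθ
    refine ⟨isExact_of_forall_Delta hx0 fun v hv => ?_, hxθ⟩
    have hconv : Convex ℝ {v : Finset N → ℝ | 0 ≤ dotProduct v x} := by
      intro v hv w hw a b ha hb _
      rw [Set.mem_ofPred_eq, add_dotProduct, smul_dotProduct, smul_dotProduct]
      exact add_nonneg (mul_nonneg ha hv) (mul_nonneg hb hw)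
    refine convexHull_min (fun v hv => ?_) hconv (hVD ▸ hv : v ∈ convexHull ℝ V)
    by_cases hvθ : v = θ
    · rw [hvθ]
      exact hxθ.ge
    · exact (hx v ⟨hv, hvθ⟩).le
  exact span_eq_of_eventually_mem (fun m hm => mem_tightSpace.2 ⟨hm.1.1, hm.2⟩)
    (hev'.self_of_nhds (mem_tightSpace.2 ⟨hp0, hpθ⟩)) hev'

lemma add_eq_one_of_sum_filter [Nonempty N] {θ : Finset N → ℝ} (hsum : ∑ S, θ S = 0)
    (hnorm : ∑ L : Finset N with L ≠ ∅ ∧ L ≠ univ, θ L = -1) : θ univ + θ ∅ = 1 := by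
  have hne : (univ : Finset N) ≠ ∅ := univ_nonempty.ne_empty
  have h := Finset.sum_filter_add_sum_filter_not univ
    (fun L : Finset N => L ≠ ∅ ∧ L ≠ univ) θ
  have h2 : (univ.filter fun L : Finset N => ¬(L ≠ ∅ ∧ L ≠ univ)) = {univ, ∅} := by
    ext L
    simp only [mem_filter, mem_univ, true_and, mem_insert, mem_singleton]
    tauto
  rw [h2, Finset.sum_pair hne] at h
  linarith

end Games

end ExactGames

theorem mainTheorem3 {N : Type*} [Fintype N] [DecidableEq N] (hN : 2 ≤ Fintype.card N)
    (θ : Finset N → ℝ) (hsum : ∑ S : Finset N, θ S = 0)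
    (hnorm : ∑ L : Finset N with L ≠ ∅ ∧ L ≠ Finset.univ, θ L = -1) :
    ExactGames.IsFacetDefining (ExactGames.exactCone N) θ 0 ↔
      θ ∈ Set.extremePoints ℝ (ExactGames.Delta N) := by
  have : Nonempty N := Fintype.card_pos_iff.1 (by omega)
  have hone := ExactGames.add_eq_one_of_sum_filter hsum hnorm
  rw [ExactGames.isFacetDefining_iff hsum hone]
  exact ⟨fun ⟨hval, hspan⟩ => ExactGames.mem_extremePoints_of_span_eq
      (ExactGames.mem_Delta_iff.2 ⟨hsum, hone, hval⟩) hspan,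
    fun hθ => ⟨(ExactGames.Delta_subset hθ.1).2.2, ExactGames.span_eq_of_mem_extremePoints hθ⟩⟩
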